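/- Let $X$ be a compact oriented smooth manifold of odd dimension $m$ with boundary $\partial X$, and give $\partial X$ the boundary orientation. For a smooth Riemannian metric $g$ on $X$ with Levi-Civita connection $\nabla^{TX}$, let $e_m$ be the inward-pointing unit normal along $\partial X$, let $e_1,\dots,e_{m-1}$ be a local orthonormal frame of $T\partial X$ for the induced metric, and let $e_1^*,\dots,e_m^*$ be the dual coframe. In the $\mathbb{Z}_2$-graded tensor product $\Lambda T^*\partial X\,\widehat\otimes\,\widehat{\Lambda T^*\partial X}$, where hats mark elements of the second factor, put $$\dot R:=\tfrac12\sum_{1\le k,j\le m-1}\langle e_k,R^{T\partial X}e_j\rangle\,\widehat{e_k^*}\wedge\widehat{e_j^*},\qquad \dot S:=\tfrac12\, j^*\nabla^{TX}\widehat{e_m^*}=\tfrac12\sum_{1\le a,b\le m-1}(\nabla^{TX}_{e_a}e_m^*)(e_b)\;e_a^*\wedge\widehat{e_b^*},$$ where $R^{T\partial X}$ is the curvature of the Levi-Civita connection of the induced metric on $\partial X$ and $j:\partial X\hookrightarrow X$ is the inclusion. Let $\int^{B_{\partial X}}:\Lambda T^*\partial X\,\widehat\otimes\,\widehat{\Lambda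 T^*\partial X}\to\Lambda T^*\partial X$ be the Berezin integral of the oriented Euclidean bundle $T\partial X$, of rank $n=m-1$: it sends $\alpha\wedge\widehat\beta$ to $(-1)^{n(n+1)/2}\pi^{-n/2}\,\beta(e_1,\dots,e_n)\,\alpha$ if $\deg\beta=n$ and $(e_1,\dots,e_n)$ is positively oriented, and to $0$ if $\deg\beta\ne n$. The Brüning–Ma secondary class of $g$ is the differential form on $\partial X$ $$B(\nabla^{TX}):=\int^{B_{\partial X}}\exp\!\left(-\tfrac12\dot R\right)\sum_{k=1}^{\infty}\frac{(-\dot S^2)^k}{4k\,\Gamma(k+1)} .$$ **Proposition (Scaling).** Let $g_1$ be a smooth Riemannian metric on $X$, let $s>0$ and put $g_2=s\cdot g_1$. Let $\nabla^{TX}_1,\nabla^{TX}_2$ be the corresponding Levi-Civita connections. Then $B(\nabla^{TX}_1)=B(\nabla^{TX}_2)$ as differential forms on $\partial X$. -/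

import Mathlib

open scoped Manifold ContDiff TensorProduct

noncomputable section

namespace BoundaryAnomaly

/-- Coordinate space `ℝ^d`. -/
abbrev Coord (d : ℕ) : Type := EuclideanSpace ℝ (Fin d)

section BoundaryManifold

variable (n : ℕ) (X : Type*) [TopologicalSpace X] [ChartedSpace (EuclideanHalfSpace (n + 1)) X]

/-- The boundary `∂X` of a manifold `X` of dimension `n + 1`. -/
abbrev Boundary : Type _ := ↥((𝓡∂ (n + 1)).boundary X)

variable {n}

/-- The coordinates other than the zeroth one of a point of the half-space `{v_0 ≥ 0}`. -/
def tailCoord (v : EuclideanHalfSpace (n + 1)) : Coord n :=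
  WithLp.toLp 2 fun i => v.1 i.succ

/-- The point `(0, u)` of the wall of the half-space. -/
def wallPoint (u : Coord n) : EuclideanHalfSpace (n + 1) :=
  ⟨WithLp.toLp 2 (Fin.cons 0 u), by simp⟩

lemma continuous_tailCoord : Continuous (tailCoord (n := n)) := by
  unfold tailCoord
  refine (PiLp.continuous_toLp 2 _).comp (continuous_pi fun i => ?_)
  exact (PiLp.continuous_apply 2 _ _).comp continuous_subtype_val

lemma continuous_wallPoint : Continuous (wallPoint (n := n)) := by
  unfold wallPoint
  refine Continuous.subtype_mk ((PiLp.continuous_toLp 2 _).comp (continuous_pi fun i => ?_)) _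
  refine Fin.cases ?_ (fun i => ?_) i
  · simpa using continuous_const
  · simpa using PiLp.continuous_apply 2 _ i

lemma tailCoord_wallPoint (u : Coord n) : tailCoord (wallPoint u) = u := by
  ext i; simp [tailCoord, wallPoint]

lemma wallPoint_tailCoord (v : EuclideanHalfSpace (n + 1)) (hv : v.1 0 = 0) :
    wallPoint (tailCoord v) = v := by
  apply EuclideanHalfSpace.ext
  ext i
  refine Fin.cases ?_ (fun i => ?_) i
  · simp [wallPoint, hv]
  · simp [tailCoord, wallPoint]

variable {X} [IsManifold (𝓡∂ (n + 1)) ∞ X]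

lemma mem_boundary_iff (p : X) {x : X}
    (hx : x ∈ (chartAt (EuclideanHalfSpace (n + 1)) p).source) :
    x ∈ (𝓡∂ (n + 1)).boundary X ↔ (chartAt (EuclideanHalfSpace (n + 1)) p x).1 0 = 0 := by
  set e := chartAt (EuclideanHalfSpace (n + 1)) p
  have h := (𝓡∂ (n + 1)).isInteriorPoint_iff_of_mem_atlas (M := X) (n := ∞) (by simp)
    (chart_mem_atlas _ p) hx
  have h2 : e.extend (𝓡∂ (n + 1)) x ∈ interior (e.extend (𝓡∂ (n + 1))).target ↔
      0 < (e x).1 0 := by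
    constructor
    · intro h
      have h' := e.interior_extend_target_subset_interior_range (I := 𝓡∂ (n + 1)) h
      rw [interior_range_modelWithCornersEuclideanHalfSpace] at h'
      exact h'
    · intro h
      refine e.mem_interior_extend_target (e.map_source hx) ?_
      rw [interior_range_modelWithCornersEuclideanHalfSpace]
      exact h
  have h3 : x ∈ (𝓡∂ (n + 1)).boundary X ↔ ¬ (𝓡∂ (n + 1)).IsInteriorPoint x :=
    ModelWithCorners.isBoundaryPoint_iff_not_isInteriorPoint x
  rw [h3, h, h2]
  have := (e x).2
  constructor
  · intro h; linarith
  · intro h; linarith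

open Classical in
/-- The chart of the boundary obtained by restriction of the preferred chart of `X` at `p`. -/
def boundaryChart (p : Boundary n X) : OpenPartialHomeomorph (Boundary n X) (Coord n) where
  toFun x := tailCoord (chartAt (EuclideanHalfSpace (n + 1)) p.1 x.1)
  invFun u :=
    if hu : (chartAt (EuclideanHalfSpace (n + 1)) p.1).symm (wallPoint u) ∈
      (𝓡∂ (n + 1)).boundary X then ⟨_, hu⟩ else p
  source := Subtype.val ⁻¹' (chartAt (EuclideanHalfSpace (n + 1)) p.1).source
  target := wallPoint ⁻¹' (chartAt (EuclideanHalfSpace (n + 1)) p.1).target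
  map_source' x hx := by
    have h := (mem_boundary_iff p.1 hx).1 x.2
    simpa [wallPoint_tailCoord _ h] using
      (chartAt (EuclideanHalfSpace (n + 1)) p.1).map_source hx
  map_target' u hu := by
    have hs := (chartAt (EuclideanHalfSpace (n + 1)) p.1).map_target hu
    have h := (mem_boundary_iff p.1 hs).2
      (by rw [OpenPartialHomeomorph.right_inv _ hu]; simp [wallPoint])
    simpa [h] using hs
  left_inv' x hx := by
    have h := (mem_boundary_iff p.1 hx).1 x.2
    have h2 : (chartAt (EuclideanHalfSpace (n + 1)) p.1).symm
        (wallPoint (tailCoord (chartAt (EuclideanHalfSpace (n + 1)) p.1 x.1))) = x.1 := by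
      rw [wallPoint_tailCoord _ h, OpenPartialHomeomorph.left_inv _ hx]
    have h3 := x.2
    rw [← h2] at h3
    rw [dif_pos h3]
    exact Subtype.ext h2
  right_inv' u hu := by
    have hs := (chartAt (EuclideanHalfSpace (n + 1)) p.1).map_target hu
    have h := (mem_boundary_iff p.1 hs).2
      (by rw [OpenPartialHomeomorph.right_inv _ hu]; simp [wallPoint])
    rw [dif_pos h]
    simp only
    rw [OpenPartialHomeomorph.right_inv _ hu, tailCoord_wallPoint]
  open_source := (chartAt _ p.1).open_source.preimage continuous_subtype_val
  open_target := (chartAt _ p.1).open_target.preimage continuous_wallPoint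
  continuousOn_toFun := continuous_tailCoord.comp_continuousOn
    ((chartAt (EuclideanHalfSpace (n + 1)) p.1).continuousOn.comp
      continuous_subtype_val.continuousOn fun _ h => h)
  continuousOn_invFun := by
    rw [Topology.IsInducing.subtypeVal.continuousOn_iff]
    refine ((chartAt (EuclideanHalfSpace (n + 1)) p.1).continuousOn_symm.comp
      continuous_wallPoint.continuousOn fun _ h => h).congr fun u hu => ?_
    have hs := (chartAt (EuclideanHalfSpace (n + 1)) p.1).map_target hu
    have h := (mem_boundary_iff p.1 hs).2
      (by rw [OpenPartialHomeomorph.right_inv _ hu]; simp [wallPoint])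
    simp [h]

lemma boundaryChart_symm_val (p : Boundary n X) {u : Coord n}
    (hu : wallPoint u ∈ (chartAt (EuclideanHalfSpace (n + 1)) p.1).target) :
    ((boundaryChart p).symm u).1 =
      (chartAt (EuclideanHalfSpace (n + 1)) p.1).symm (wallPoint u) := by
  have hs := (chartAt (EuclideanHalfSpace (n + 1)) p.1).map_target hu
  have h := (mem_boundary_iff p.1 hs).2
    (by rw [OpenPartialHomeomorph.right_inv _ hu]; simp [wallPoint])
  exact congrArg Subtype.val (dif_pos h)

/-- The boundary as a manifold of dimension `n`, through restricted charts of `X`. -/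
instance boundaryChartedSpace : ChartedSpace (Coord n) (Boundary n X) where
  atlas := Set.range boundaryChart
  chartAt := boundaryChart
  mem_chart_source p := mem_chart_source (EuclideanHalfSpace (n + 1)) p.1
  chart_mem_atlas p := ⟨p, rfl⟩

/-- The boundary is a smooth manifold. -/
instance boundaryIsManifold : IsManifold (𝓡 n) ∞ (Boundary n X) := by
  apply isManifold_of_contDiffOn
  rintro _ _ ⟨p, rfl⟩ ⟨q, rfl⟩
  have h := (𝓡∂ (n + 1)).contDiffOn_extendCoordChange (n := ∞)
    (IsManifold.chart_mem_maximalAtlas (I := 𝓡∂ (n + 1)) (n := ∞) p.1)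
    (IsManifold.chart_mem_maximalAtlas (I := 𝓡∂ (n + 1)) (n := ∞) q.1)
  have hw : ContDiff ℝ ∞ fun u : Coord n => (wallPoint u).1 := by
    unfold wallPoint
    rw [contDiff_euclidean]
    refine Fin.cases ?_ fun i => ?_
    · simpa using contDiff_const
    · simp; fun_prop
  have ht : ContDiff ℝ ∞ fun v : Coord (n + 1) => (WithLp.toLp 2 fun i : Fin n => v i.succ : Coord n) := by
    rw [contDiff_euclidean]
    intro i
    simp; fun_prop
  have key : ∀ u ∈ (𝓡 n).symm ⁻¹' ((boundaryChart p).symm ≫ₕ boundaryChart q).source ∩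
      Set.range (𝓡 n), wallPoint u ∈ (chartAt (EuclideanHalfSpace (n + 1)) p.1).target ∧
        (chartAt (EuclideanHalfSpace (n + 1)) p.1).symm (wallPoint u) ∈
          (chartAt (EuclideanHalfSpace (n + 1)) q.1).source := by
    rintro u ⟨⟨h1, h2⟩, -⟩
    refine ⟨h1, ?_⟩
    have h3 : ((boundaryChart p).symm u).1 ∈
      (chartAt (EuclideanHalfSpace (n + 1)) q.1).source := h2
    exact boundaryChart_symm_val p h1 ▸ h3
  refine (ht.comp_contDiffOn (h.comp hw.contDiffOn ?_)).congr ?_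
  · intro u hu
    rw [ModelWithCorners.extendCoordChange_source]
    refine ⟨wallPoint u, ⟨(key u hu).1, (key u hu).2⟩, rfl⟩
  · intro u hu
    have h1 := boundaryChart_symm_val p (key u hu).1
    have h2 : (𝓡∂ (n + 1)).symm (wallPoint u).1 = wallPoint u :=
      (𝓡∂ (n + 1)).left_inv (wallPoint u)
    change tailCoord (chartAt (EuclideanHalfSpace (n + 1)) q.1
      ((boundaryChart p).symm u).1) = tailCoord (chartAt (EuclideanHalfSpace (n + 1)) q.1
        ((chartAt (EuclideanHalfSpace (n + 1)) p.1).symm ((𝓡∂ (n + 1)).symm (wallPoint u).1)))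
    rw [h1, h2]


/-- The linear map `v ↦ (0, v)`. -/
def wallCLM (n : ℕ) : Coord n →L[ℝ] Coord (n + 1) :=
  LinearMap.toContinuousLinearMap
    { toFun := fun v => WithLp.toLp 2 (Fin.cons 0 v)
      map_add' := fun v w => by
        ext i; refine Fin.cases ?_ (fun i => ?_) i <;> simp
      map_smul' := fun c v => by
        ext i; refine Fin.cases ?_ (fun i => ?_) i <;> simp }

lemma hasMFDerivAt_boundary_val (y : Boundary n X) :
    HasMFDerivAt (𝓡 n) (𝓡∂ (n + 1)) (Subtype.val : Boundary n X → X) y (wallCLM n) := by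
  refine ⟨continuous_subtype_val.continuousAt, ?_⟩
  have h0 : HasFDerivWithinAt (fun u : Coord n => (wallPoint u).1) (wallCLM n)
      (Set.range (𝓡 n)) (extChartAt (𝓡 n) y y) := by
    have : (fun u : Coord n => (wallPoint u).1) = wallCLM n := rfl
    rw [this]
    exact (wallCLM n).hasFDerivWithinAt
  have hy : extChartAt (𝓡 n) y y ∈ (boundaryChart y).target :=
    (boundaryChart y).map_source (mem_chart_source (EuclideanHalfSpace (n + 1)) y.1)
  have key : ∀ u ∈ (boundaryChart y).target,
      writtenInExtChartAt (𝓡 n) (𝓡∂ (n + 1)) y (Subtype.val : Boundary n X → X) u =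
        (wallPoint u).1 := by
    intro u hu
    change (chartAt (EuclideanHalfSpace (n + 1)) y.1 ((boundaryChart y).symm u).1).1 = _
    have hu' : wallPoint u ∈ (chartAt (EuclideanHalfSpace (n + 1)) y.1).target := hu
    rw [boundaryChart_symm_val y hu', OpenPartialHomeomorph.right_inv _ hu']
  refine h0.congr_of_eventuallyEq ?_ (key _ hy)
  exact Filter.eventually_of_mem
    (mem_nhdsWithin_of_mem_nhds ((boundaryChart y).open_target.mem_nhds hy)) key

end BoundaryManifold

section LeviCivita

/-- A (not necessarily smooth) family of bilinear forms on the tangent spaces of `M`. -/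
abbrev BilinField {d : ℕ} {H : Type*} [TopologicalSpace H] (I : ModelWithCorners ℝ (Coord d) H)
    (M : Type*) [TopologicalSpace M] [ChartedSpace H M] : Type _ :=
  ∀ x : M, LinearMap.BilinForm ℝ (TangentSpace I x)

variable {d : ℕ} {H : Type*} [TopologicalSpace H] {M : Type*} [TopologicalSpace M]
  [ChartedSpace H M] {I : ModelWithCorners ℝ (Coord d) H}

/-- The coefficients `g_{ij}(u) = g(∂_i, ∂_j)` of `g` in the preferred chart at `p`, as functions
of the coordinate point `u`. -/
def metricCoeff (g : BilinField I M) (p : M) (u : Coord d) : Matrix (Fin d) (Fin d) ℝ :=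
  let D := mfderivWithin 𝓘(ℝ, Coord d) I (extChartAt I p).symm (Set.range I) u
  Matrix.of fun i j => g ((extChartAt I p).symm u)
    (D (EuclideanSpace.single i 1)) (D (EuclideanSpace.single j 1))

variable (I) in
/-- The partial derivative `∂_i f` at `u` (one-sided at the edge of the model). -/
def coordDeriv (i : Fin d) (f : Coord d → ℝ) (u : Coord d) : ℝ :=
  fderivWithin ℝ f (Set.range I) u (EuclideanSpace.single i 1)

/-- The Christoffel symbols `Γ^k_{ij}` of the Levi-Civita connection of `g`, that is
`∇_{∂_i} ∂_j = ∑ k, Γ^k_{ij} ∂_k`, in the preferred chart at `p`. -/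
def christoffel (g : BilinField I M) (p : M) (k i j : Fin d) (u : Coord d) : ℝ :=
  (1 / 2) * ∑ l, (metricCoeff g p u)⁻¹ k l *
    (coordDeriv I i (fun z => metricCoeff g p z j l) u
      + coordDeriv I j (fun z => metricCoeff g p z i l) u
      - coordDeriv I l (fun z => metricCoeff g p z i j) u)

/-- The coefficients of the curvature `R = ∇²` of the Levi-Civita connection:
`R(∂_i, ∂_j) ∂_k = ∑ l, R^l_{ijk} ∂_l`. -/
def curvatureCoeff (g : BilinField I M) (p : M) (l i j k : Fin d) (u : Coord d) : ℝ :=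
  coordDeriv I i (christoffel g p l j k) u - coordDeriv I j (christoffel g p l i k) u
    + ∑ a, (christoffel g p l i a u * christoffel g p a j k u
      - christoffel g p l j a u * christoffel g p a i k u)

/-- The coordinates of a tangent vector at `p` in the preferred chart at `p`. -/
def tangentCoord (p : M) (v : TangentSpace I p) (i : Fin d) : ℝ :=
  (show Coord d from v) i

/-- The tangent vector at `p` with given coordinates in the preferred chart at `p`. -/
def tangentVec (p : M) (c : Fin d → ℝ) : TangentSpace I p :=
  show Coord d from WithLp.toLp 2 c

/-- The curvature operator `R(v, w) z` of the Levi-Civita connection of `g` at `p`. -/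
def curvature (g : BilinField I M) (p : M) (v w z : TangentSpace I p) : TangentSpace I p :=
  tangentVec p fun l => ∑ i, ∑ j, ∑ k,
    tangentCoord p v i * tangentCoord p w j * tangentCoord p z k *
      curvatureCoeff g p l i j k (extChartAt I p p)

/-- The coefficients `(∇_{∂_i} θ)_j` of the covariant derivative of a one-form `θ = ∑ j, θ_j dx^j`
for the Levi-Civita connection of `g`, in the preferred chart at `p`. -/
def covDerivForm (g : BilinField I M) (p : M) (θ : Fin d → Coord d → ℝ) (i j : Fin d)
    (u : Coord d) : ℝ :=
  coordDeriv I i (θ j) u - ∑ k, christoffel g p k i j u * θ k u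

end LeviCivita

section Boundary

variable {n : ℕ} {X : Type*} [TopologicalSpace X] [ChartedSpace (EuclideanHalfSpace (n + 1)) X]
  [IsManifold (𝓡∂ (n + 1)) ∞ X]

variable (n X) in
/-- Smooth Riemannian metrics on `X`. -/
abbrev SmoothMetric : Type _ :=
  Bundle.ContMDiffRiemannianMetric (𝓡∂ (n + 1)) ∞ (Coord (n + 1))
    (fun x : X => TangentSpace (𝓡∂ (n + 1)) x)

variable (n X) in
/-- An orientation of the manifold `X`: an orientation of every tangent space, which is locally
constant when the tangent spaces are identified through a chart. -/
structure ManifoldOrientation where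
  /-- The orientation of each tangent space. -/
  orient : ∀ x : X, Orientation ℝ (TangentSpace (𝓡∂ (n + 1)) x) (Fin (n + 1))
  locallyConstant : ∀ x₀ : X, ∃ o : Orientation ℝ (Coord (n + 1)) (Fin (n + 1)),
    ∀ᶠ x in nhds x₀, ∃ L : TangentSpace (𝓡∂ (n + 1)) x ≃ₗ[ℝ] Coord (n + 1),
      (∀ v, L v = mfderiv (𝓡∂ (n + 1)) 𝓘(ℝ, Coord (n + 1))
        (extChartAt (𝓡∂ (n + 1)) x₀) x v) ∧
      Orientation.map (Fin (n + 1)) L (orient x) = o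

/-- The differential at `y` of the inclusion of the boundary, `T_y∂X → T_yX`. -/
def boundaryInclusion (y : Boundary n X) :
    TangentSpace (𝓡 n) y →L[ℝ] TangentSpace (𝓡∂ (n + 1)) y.1 :=
  mfderiv (𝓡 n) (𝓡∂ (n + 1)) (Subtype.val : Boundary n X → X) y

/-- The bilinear forms underlying a Riemannian metric. -/
def metricForm (g : SmoothMetric n X) : BilinField (𝓡∂ (n + 1)) X := fun x =>
  LinearMap.mk₂ ℝ (fun v w => g.inner x v w)
    (fun _ _ _ => by simp) (fun _ _ _ => by simp) (fun _ _ _ => by simp) (fun _ _ _ => by simp)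

/-- The metric induced on the boundary by the metric `g` of `X`. -/
def boundaryMetric (g : SmoothMetric n X) : BilinField (𝓡 n) (Boundary n X) := fun y =>
  (metricForm g y.1).compl₁₂ (boundaryInclusion y).toLinearMap (boundaryInclusion y).toLinearMap

lemma boundaryInclusion_injective (y : Boundary n X) :
    Function.Injective (boundaryInclusion y) := by
  unfold boundaryInclusion
  rw [(hasMFDerivAt_boundary_val y).mfderiv]
  intro v w h
  have h' : ∀ i : Fin (n + 1), (Fin.cons 0 (show Coord n from v) : Fin (n + 1) → ℝ) i =
      (Fin.cons 0 (show Coord n from w) : Fin (n + 1) → ℝ) i := fun i =>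
    congrArg (fun z : Coord (n + 1) => z i) h
  have : (show Coord n from v) = (show Coord n from w) := by
    ext i; simpa using h' i.succ
  exact this

/-- `e` is an orthonormal basis of `T_y∂X`. -/
def IsOrthonormalFrame (g : SmoothMetric n X) (y : Boundary n X)
    (e : Module.Basis (Fin n) ℝ (TangentSpace (𝓡 n) y)) : Prop :=
  ∀ i j, boundaryMetric g y (e i) (e j) = if i = j then 1 else 0

lemma exists_orthonormalFrame (g : SmoothMetric n X) (y : Boundary n X) :
    ∃ e : Module.Basis (Fin n) ℝ (TangentSpace (𝓡 n) y), IsOrthonormalFrame g y e := by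
  let V := TangentSpace (𝓡 n) y
  have : FiniteDimensional ℝ V := inferInstanceAs (FiniteDimensional ℝ (Coord n))
  have hdim : Module.finrank ℝ V = n := finrank_euclideanSpace_fin (𝕜 := ℝ) (n := n)
  let B : LinearMap.BilinForm ℝ V := boundaryMetric g y
  have hsymm : LinearMap.IsSymm B := ⟨fun v w => g.symm y.1 _ _⟩
  obtain ⟨b, hb⟩ := LinearMap.BilinForm.exists_orthogonal_basis (K := ℝ) (V := V) (B := B) hsymm
  have hpos : ∀ i, 0 < B (b i) (b i) := fun i =>
    g.pos y.1 _ fun h => b.ne_zero i (boundaryInclusion_injective y (h.trans (map_zero _).symm))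
  have hu : ∀ i, IsUnit ((√(B (b i) (b i)))⁻¹) := fun i =>
    (inv_ne_zero (Real.sqrt_pos.2 (hpos i)).ne').isUnit
  refine ⟨(b.isUnitSMul hu).reindex (finCongr hdim), fun i j => ?_⟩
  set i' := (finCongr hdim).symm i with hi'
  set j' := (finCongr hdim).symm j with hj'
  have h1 : boundaryMetric g y (((b.isUnitSMul hu).reindex (finCongr hdim)) i)
      (((b.isUnitSMul hu).reindex (finCongr hdim)) j) =
      (√(B (b i') (b i')))⁻¹ * ((√(B (b j') (b j')))⁻¹ * B (b i') (b j')) := by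
    rw [Module.Basis.reindex_apply, Module.Basis.reindex_apply, Module.Basis.isUnitSMul_apply,
      Module.Basis.isUnitSMul_apply]
    change B _ _ = _
    simp [i', j']
    ring
  rw [h1]
  by_cases hij : i = j
  · subst hij
    have := Real.mul_self_sqrt (hpos i').le
    have h3 := (Real.sqrt_pos.2 (hpos i')).ne'
    rw [if_pos rfl]
    change (√(B (b i') (b i')))⁻¹ * ((√(B (b i') (b i')))⁻¹ * B (b i') (b i')) = 1
    field_simp
    nlinarith
  · have h2 : i' ≠ j' := fun h => hij ((finCongr hdim).symm.injective h)
    rw [if_neg hij, hb h2]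
    simp

/-- Coordinates of the unit normal field along the boundary: the normalized gradient of the
coordinate `x_0`. Since `X` is `{x_0 ≥ 0}` in a chart, it is the inward-pointing one. -/
def unitNormalCoeff (g : SmoothMetric n X) (p : X) (k : Fin (n + 1)) (u : Coord (n + 1)) : ℝ :=
  (metricCoeff (metricForm g) p u)⁻¹ k 0 /
    √((metricCoeff (metricForm g) p u)⁻¹ 0 0)

/-- The inward-pointing unit normal vector `e_m` at a boundary point. -/
def unitNormal (g : SmoothMetric n X) (y : Boundary n X) : TangentSpace (𝓡∂ (n + 1)) y.1 :=
  tangentVec y.1 fun k => unitNormalCoeff g y.1 k (extChartAt (𝓡∂ (n + 1)) y.1 y.1)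

/-- Coordinates of the dual covector `e_m^* = g(e_m, ·)` of the unit normal field. -/
def unitConormalCoeff (g : SmoothMetric n X) (p : X) (j : Fin (n + 1)) (u : Coord (n + 1)) : ℝ :=
  ∑ k, metricCoeff (metricForm g) p u j k * unitNormalCoeff g p k u

/-- `(∇^{TX}_v e_m^*)(w)` for `v, w` tangent to the boundary. -/
def normalDeriv (g : SmoothMetric n X) (y : Boundary n X) (v w : TangentSpace (𝓡 n) y) : ℝ :=
  ∑ i, ∑ j, tangentCoord y.1 (boundaryInclusion y v) i *
    tangentCoord y.1 (boundaryInclusion y w) j *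
    covDerivForm (metricForm g) y.1 (unitConormalCoeff g y.1) i j
      (extChartAt (𝓡∂ (n + 1)) y.1 y.1)

open Classical in
/-- `1` if the basis `e` of `T_y∂X` is positive for the boundary orientation (outward normal
first), and `-1` otherwise. -/
def frameSign (o : ManifoldOrientation n X) (g : SmoothMetric n X) (y : Boundary n X)
    (e : Module.Basis (Fin n) ℝ (TangentSpace (𝓡 n) y)) : ℝ :=
  if ∃ b : Module.Basis (Fin (n + 1)) ℝ (TangentSpace (𝓡∂ (n + 1)) y.1),
      b 0 = -unitNormal g y ∧ (∀ i, b i.succ = boundaryInclusion y (e i)) ∧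
        b.orientation = o.orient y.1
  then 1 else -1

end Boundary

section Berezin

/-- The graded tensor product `Λ V ⊗̂ Λ V`; the second factor is the one that carries hats. -/
abbrev DoubleExterior (V : Type*) [AddCommGroup V] [Module ℝ V] : Type _ :=
  (fun i : ℕ => ⋀[ℝ]^i V) ᵍ⊗[ℝ] (fun i : ℕ => ⋀[ℝ]^i V)

/-- The element `α β̂` of `Λ V ⊗̂ Λ V`. -/
def hatMul {V : Type*} [AddCommGroup V] [Module ℝ V] (α β : ExteriorAlgebra ℝ V) :
    DoubleExterior V :=
  GradedTensorProduct.tmul ℝ α β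

/-- The exponential series; it is a finite sum on nilpotent elements. -/
def nilExp {A : Type*} [Ring A] [Module ℝ A] (a : A) : A :=
  ∑ᶠ k : ℕ, ((k.factorial : ℝ)⁻¹) • a ^ k

variable {n : ℕ} {V : Type*} [AddCommGroup V] [Module ℝ V]

/-- Evaluation `β ↦ β(e_1, …, e_n)` on forms of degree `n`, and zero on the other degrees. -/
def topEval (e : Module.Basis (Fin n) ℝ V) :
    ExteriorAlgebra ℝ (Module.Dual ℝ V) →ₗ[ℝ] ℝ :=
  ExteriorAlgebra.liftAlternating fun i =>
    if h : n = i then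
      h ▸ (Matrix.detRowAlternating (R := ℝ) (n := Fin n)).compLinearMap
        (LinearMap.pi fun j => Module.Dual.eval ℝ V (e j))
    else 0

/-- The Berezin integral for the basis `e`, whose sign with respect to the orientation is `ε`:
`α β̂ ↦ (-1)^{n(n+1)/2} π^{-n/2} ε β(e_1, …, e_n) α`. -/
def berezin (e : Module.Basis (Fin n) ℝ V) (ε : ℝ) :
    DoubleExterior (Module.Dual ℝ V) →ₗ[ℝ] ExteriorAlgebra ℝ (Module.Dual ℝ V) :=
  ((-1) ^ (n * (n + 1) / 2) * Real.pi ^ (-(n : ℝ) / 2) * ε) •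
    ((TensorProduct.rid ℝ (ExteriorAlgebra ℝ (Module.Dual ℝ V))).toLinearMap ∘ₗ
      TensorProduct.map LinearMap.id (topEval e) ∘ₗ
      (GradedTensorProduct.of ℝ (fun i : ℕ => ⋀[ℝ]^i (Module.Dual ℝ V))
        (fun i : ℕ => ⋀[ℝ]^i (Module.Dual ℝ V))).symm.toLinearMap)

end Berezin

section SecondaryClass

variable {n : ℕ} {X : Type*} [TopologicalSpace X] [ChartedSpace (EuclideanHalfSpace (n + 1)) X]
  [IsManifold (𝓡∂ (n + 1)) ∞ X]

/-- The element `e^k` of the dual basis, in the exterior algebra of `T_y^*∂X`. -/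
def coframe {y : Boundary n X} (e : Module.Basis (Fin n) ℝ (TangentSpace (𝓡 n) y)) (k : Fin n) :
    ExteriorAlgebra ℝ (Module.Dual ℝ (TangentSpace (𝓡 n) y)) :=
  ExteriorAlgebra.ι ℝ (e.coord k)

/-- The two-form `⟨e_k, R^{T∂X} e_j⟩`, whose value on `(v, w)` is `⟨e_k, R^{T∂X}(v, w) e_j⟩`. -/
def curvatureForm (g : SmoothMetric n X) (y : Boundary n X)
    (e : Module.Basis (Fin n) ℝ (TangentSpace (𝓡 n) y)) (k j : Fin n) :
    ExteriorAlgebra ℝ (Module.Dual ℝ (TangentSpace (𝓡 n) y)) :=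
  (1 / 2 : ℝ) • ∑ a, ∑ b,
    boundaryMetric g y (e k) (curvature (boundaryMetric g) y (e a) (e b) (e j)) •
      (coframe e a * coframe e b)

/-- `Ṙ^{T∂X} = 1/2 ∑_{k,j} ⟨e_k, R^{T∂X} e_j⟩ ê^k ∧ ê^j`. -/
def dotR (g : SmoothMetric n X) (y : Boundary n X)
    (e : Module.Basis (Fin n) ℝ (TangentSpace (𝓡 n) y)) :
    DoubleExterior (Module.Dual ℝ (TangentSpace (𝓡 n) y)) :=
  (1 / 2 : ℝ) • ∑ k, ∑ j, hatMul (curvatureForm g y e k j) (coframe e k * coframe e j)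

/-- `Ṡ = 1/2 j^* ∇^{TX} ê_m^*`. The covector `∇_v e_m^*` vanishes on `e_m`, because `e_m^*` has
length one, so it is a combination of the covectors `e^b` of the boundary. -/
def dotS (g : SmoothMetric n X) (y : Boundary n X)
    (e : Module.Basis (Fin n) ℝ (TangentSpace (𝓡 n) y)) :
    DoubleExterior (Module.Dual ℝ (TangentSpace (𝓡 n) y)) :=
  (1 / 2 : ℝ) • ∑ a, ∑ b, normalDeriv g y (e a) (e b) • hatMul (coframe e a) (coframe e b)

/-- The value at `y` of the secondary form, computed in the orthonormal basis `e`. The sum is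
finite, since `Ṡ` is nilpotent. -/
def secondaryFormIn (o : ManifoldOrientation n X) (g : SmoothMetric n X) (y : Boundary n X)
    (e : Module.Basis (Fin n) ℝ (TangentSpace (𝓡 n) y)) :
    ExteriorAlgebra ℝ (Module.Dual ℝ (TangentSpace (𝓡 n) y)) :=
  berezin e (frameSign o g y e)
    (nilExp (-((1 / 2 : ℝ) • dotR g y e)) *
      ∑ᶠ (k : ℕ) (_ : 1 ≤ k), ((4 * (k : ℝ) * Real.Gamma (k + 1))⁻¹) • (-(dotS g y e ^ 2)) ^ k)

/-- The Brüning–Ma secondary form `B(∇^{TX})`, a differential form on the boundary. Its value at a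
point is computed in an orthonormal basis there, and does not depend on that basis. -/
def secondaryForm (o : ManifoldOrientation n X) (g : SmoothMetric n X) (y : Boundary n X) :
    ExteriorAlgebra ℝ (Module.Dual ℝ (TangentSpace (𝓡 n) y)) :=
  secondaryFormIn o g y (exists_orthonormalFrame g y).choose

end SecondaryClass

end BoundaryAnomaly

end

/-!
If `g₂ = s g₁`, the two Levi-Civita connections agree, the unit conormal is multiplied by `√s` and
the pairing `⟨e_k, R e_j⟩` by `s`. Since `Ṡ` has one hatted covector and `Ṙ` has two, `Ṡ₂` and `Ṙ₂`
are the images of `Ṡ₁` and `Ṙ₁` under the algebra endomorphism that multiplies every hatted covector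
by `√s`. The Berezin integral only sees the top hatted degree `n`, where this endomorphism is
multiplication by `s^{n/2}`; that factor is the inverse of the determinant of the change from a
`g₁`-orthonormal frame to a `g₂`-orthonormal frame of the same orientation.
-/

noncomputable section

namespace BoundaryAnomaly

section LinearAlgebra

variable {K V W : Type*} [Field K] [AddCommGroup V] [Module K V] [AddCommGroup W] [Module K W]

lemma matrix_inv_smul {ι : Type*} [Fintype ι] [DecidableEq ι] (c : K) (A : Matrix ι ι K) :
    (c • A)⁻¹ = c⁻¹ • A⁻¹ := by
  obtain rfl | hc := eq_or_ne c 0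
  · simp
  by_cases hA : IsUnit A.det
  · exact A.inv_smul' (Units.mk0 c hc) hA
  · have hcA : ¬ IsUnit (c • A).det := fun h =>
      hA (isUnit_of_mul_isUnit_right (Matrix.det_smul A c ▸ h))
    rw [Matrix.nonsing_inv_apply_not_isUnit _ hcA, Matrix.nonsing_inv_apply_not_isUnit _ hA,
      smul_zero]

lemma det_dualBasis_dualBasis {ι : Type*} [Fintype ι] [DecidableEq ι]
    (e e' : Module.Basis ι K V) : e'.dualBasis.det e.dualBasis = e.det e' := by
  rw [Module.Basis.det_apply, Module.Basis.det_apply, ← Matrix.det_transpose]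
  congr 1
  ext i j
  simp [Module.Basis.toMatrix_apply]

lemma det_toMatrix_bilinForm_eq {ι : Type*} [Fintype ι] [DecidableEq ι]
    (B : LinearMap.BilinForm K V) (e e' : Module.Basis ι K V) :
    (LinearMap.BilinForm.toMatrix e' B).det =
      e.det e' ^ 2 * (LinearMap.BilinForm.toMatrix e B).det := by
  rw [← LinearMap.BilinForm.toMatrix_mul_basis_toMatrix e e' B, Matrix.det_mul, Matrix.det_mul,
    Matrix.det_transpose, Module.Basis.det_apply]
  ring

variable {n : ℕ}

lemma exists_basis_finCons [FiniteDimensional K W] (hW : Module.finrank K W = n + 1)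
    {J : V →ₗ[K] W} (hJ : Function.Injective J) (e : Module.Basis (Fin n) K V) {ν : W}
    (hν : ν ∉ LinearMap.range J) :
    ∃ b : Module.Basis (Fin (n + 1)) K W, b 0 = ν ∧ ∀ i, b i.succ = J (e i) := by
  have hli : LinearIndependent K (Fin.cons ν (J ∘ e) : Fin (n + 1) → W) := by
    refine linearIndependent_finCons.2
      ⟨e.linearIndependent.map' J (LinearMap.ker_eq_bot.2 hJ), fun h => hν ?_⟩
    have hle : Submodule.span K (Set.range (J ∘ e)) ≤ LinearMap.range J :=
      Submodule.span_le.2 (Set.range_subset_iff.2 fun i => LinearMap.mem_range_self J (e i))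
    exact hle h
  refine ⟨basisOfLinearIndependentOfCardEqFinrank hli (by simp [hW]), ?_, fun i => ?_⟩ <;>
    simp

/-- Both sides are the value at `e'` of the alternating form `v ↦ b.det (c • b 0, J v)` on `V`. -/
lemma det_finCons_eq_mul_det (J : V →ₗ[K] W) {e e' : Module.Basis (Fin n) K V}
    {b b' : Module.Basis (Fin (n + 1)) K W} {c : K} (h₀ : b' 0 = c • b 0)
    (hb : ∀ i, b i.succ = J (e i)) (hb' : ∀ i, b' i.succ = J (e' i)) :
    b.det b' = c * e.det e' := by
  let η : V [⋀^Fin n]→ₗ[K] K := (b.det.curryLeft (c • b 0)).compLinearMap J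
  have hη' : η e' = b.det b' :=
    congrArg b.det (funext (Fin.cases h₀.symm fun i => (hb' i).symm))
  have hη : η e = c := by
    have hcons : (Matrix.vecCons (b 0) fun i => J (e i)) = b :=
      funext (Fin.cases rfl fun i => (hb i).symm)
    simp [η, hcons, b.det_self]
  rw [← hη', η.eq_smul_basis_det e, AlternatingMap.smul_apply, hη, smul_eq_mul]

end LinearAlgebra

section Contraction

variable {R ι ι' V A B W : Type*} [CommRing R] [Fintype ι] [Fintype ι'] [AddCommGroup V]
  [Module R V] [AddCommGroup A] [Module R A] [AddCommGroup B] [Module R B] [AddCommGroup W]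
  [Module R W]

lemma sum_apply_coord_eq (e : Module.Basis ι R V) (e' : Module.Basis ι' R V)
    (F : V →ₗ[R] Module.Dual R V →ₗ[R] W) :
    ∑ a, F (e a) (e.coord a) = ∑ b, F (e' b) (e'.coord b) :=
  calc ∑ a, F (e a) (e.coord a)
    _ = ∑ a, F (e a) (∑ b, e.coord a (e' b) • e'.coord b) := by
      simp only [Module.Basis.sum_dual_apply_smul_coord]
    _ = ∑ b, F (∑ a, e.coord a (e' b) • e a) (e'.coord b) := by
      simp only [map_sum, map_smul, LinearMap.sum_apply, LinearMap.smul_apply]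
      exact Finset.sum_comm
    _ = ∑ b, F (e' b) (e'.coord b) := by
      simp only [Module.Basis.coord_apply, Module.Basis.sum_repr]

lemma sum_sum_apply_coord_eq (e : Module.Basis ι R V) (e' : Module.Basis ι' R V)
    (N : V →ₗ[R] V →ₗ[R] A) (P : Module.Dual R V →ₗ[R] Module.Dual R V →ₗ[R] B)
    (Q : A →ₗ[R] B →ₗ[R] W) :
    ∑ a, ∑ b, Q (N (e a) (e b)) (P (e.coord a) (e.coord b)) =
      ∑ a, ∑ b, Q (N (e' a) (e' b)) (P (e'.coord a) (e'.coord b)) :=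
  calc ∑ a, ∑ b, Q (N (e a) (e b)) (P (e.coord a) (e.coord b))
    _ = ∑ a, ∑ b, Q (N (e a) (e' b)) (P (e.coord a) (e'.coord b)) :=
      Finset.sum_congr rfl fun a _ =>
        sum_apply_coord_eq e e' (Q.compl₁₂ (N (e a)) (P (e.coord a)))
    _ = ∑ b, ∑ a, Q (N (e a) (e' b)) (P (e.coord a) (e'.coord b)) := Finset.sum_comm
    _ = ∑ b, ∑ a, Q (N (e' a) (e' b)) (P (e'.coord a) (e'.coord b)) :=
      Finset.sum_congr rfl fun b _ =>
        sum_apply_coord_eq e e' (Q.compl₁₂ (N.flip (e' b)) (P.flip (e'.coord b)))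
    _ = ∑ a, ∑ b, Q (N (e' a) (e' b)) (P (e'.coord a) (e'.coord b)) := Finset.sum_comm

end Contraction

section OrientationSign

variable {K ι V : Type*} [Field K] [LinearOrder K] [IsStrictOrderedRing K] [Fintype ι]
  [DecidableEq ι] [AddCommGroup V] [Module K V]

open Classical in
/-- The sign of a basis with respect to an orientation: `1` for a positive basis, `-1` for a
negative one. -/
def orientationSign (o : Orientation K V ι) (b : Module.Basis ι K V) : K :=
  if b.orientation = o then 1 else -1

lemma det_mul_orientationSign (o : Orientation K V ι) (b b' : Module.Basis ι K V) :
    b.det b' * orientationSign o b' = |b.det b'| * orientationSign o b := by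
  obtain hneg | hpos := (b.isUnit_det b').ne_zero.lt_or_gt
  · have hbb' : b'.orientation = -b.orientation :=
      (b.orientation_ne_iff_eq_neg _).1 fun h =>
        hneg.not_gt ((b.orientation_eq_iff_det_pos b').1 h.symm)
    have hiff : b'.orientation = o ↔ b.orientation ≠ o := by
      rw [hbb', ne_comm, b.orientation_ne_iff_eq_neg, eq_comm]
    by_cases h : b.orientation = o <;> simp [orientationSign, hiff, h, abs_of_neg hneg]
  · have hbb' : b.orientation = b'.orientation := (b.orientation_eq_iff_det_pos b').2 hpos
    rw [orientationSign, orientationSign, hbb', abs_of_pos hpos]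

end OrientationSign

section DoubleExterior

variable {V W : Type*} [AddCommGroup V] [Module ℝ V] [AddCommGroup W] [Module ℝ W]

/-- The bilinear map `(α, β) ↦ α β̂`. -/
def hatMulLin (V : Type*) [AddCommGroup V] [Module ℝ V] :
    ExteriorAlgebra ℝ V →ₗ[ℝ] ExteriorAlgebra ℝ V →ₗ[ℝ] DoubleExterior V :=
  (TensorProduct.mk ℝ (ExteriorAlgebra ℝ V) (ExteriorAlgebra ℝ V)).compr₂
    (GradedTensorProduct.of ℝ (fun i : ℕ => ⋀[ℝ]^i V) (fun i : ℕ => ⋀[ℝ]^i V)).toLinearMap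

lemma hatMulLin_apply (α β : ExteriorAlgebra ℝ V) : hatMulLin V α β = hatMul α β := rfl

lemma hatMul_smul_left (c : ℝ) (α β : ExteriorAlgebra ℝ V) :
    hatMul (c • α) β = c • hatMul α β := by
  simp only [← hatMulLin_apply, map_smul, LinearMap.smul_apply]

lemma hatMul_smul_right (c : ℝ) (α β : ExteriorAlgebra ℝ V) :
    hatMul α (c • β) = c • hatMul α β := by
  simp only [← hatMulLin_apply, map_smul]

lemma doubleExterior_linearMap_ext {f g : DoubleExterior V →ₗ[ℝ] W}
    (h : ∀ α β, f (hatMul α β) = g (hatMul α β)) : f = g :=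
  GradedTensorProduct.hom_ext _ _ (TensorProduct.ext' h)

lemma map_mem_exteriorPower (f : V →ₗ[ℝ] W) {i : ℕ} {x : ExteriorAlgebra ℝ V}
    (hx : x ∈ ⋀[ℝ]^i V) : ExteriorAlgebra.map f x ∈ ⋀[ℝ]^i W := by
  have hle : Submodule.map (ExteriorAlgebra.map f).toLinearMap (⋀[ℝ]^i V) ≤ ⋀[ℝ]^i W := by
    rw [Submodule.map_pow]
    refine pow_le_pow_left' ?_ i
    rintro _ ⟨_, ⟨v, rfl⟩, rfl⟩
    exact ⟨f v, by simp⟩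
  exact hle ⟨x, hx, rfl⟩

/-- The endomorphism `α β̂ ↦ α (f β)^` of `Λ V ⊗̂ Λ V` by which an endomorphism `f` of `V` acts on
the hatted factor. -/
def hatMap (f : V →ₗ[ℝ] V) : DoubleExterior V →ₐ[ℝ] DoubleExterior V :=
  GradedTensorProduct.lift (fun i : ℕ => ⋀[ℝ]^i V) (fun i : ℕ => ⋀[ℝ]^i V)
    (GradedTensorProduct.includeLeft _ _)
    ((GradedTensorProduct.includeRight _ _).comp (ExteriorAlgebra.map f))
    (fun i j a b => by
      have hcomm := GradedTensorProduct.tmul_coe_mul_coe_tmul (R := ℝ) (fun i : ℕ => ⋀[ℝ]^i V)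
        (fun i : ℕ => ⋀[ℝ]^i V) 1 ⟨_, map_mem_exteriorPower f b.2⟩ a 1
      simp only [AlgHom.comp_apply, GradedTensorProduct.includeLeft_apply,
        GradedTensorProduct.includeRight_apply]
      rw [GradedTensorProduct.tmul_one_mul_one_tmul, hcomm, smul_smul, Int.units_mul_self,
        one_smul, one_mul, mul_one])

lemma hatMap_hatMul (f : V →ₗ[ℝ] V) (α β : ExteriorAlgebra ℝ V) :
    hatMap f (hatMul α β) = hatMul α (ExteriorAlgebra.map f β) := by
  unfold hatMap hatMul
  rw [GradedTensorProduct.lift_tmul]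
  exact GradedTensorProduct.tmul_one_mul_one_tmul _ _ _ _

lemma hatMap_injective {f : V →ₗ[ℝ] V} (hf : Function.Injective f) :
    Function.Injective (hatMap f) := by
  obtain ⟨g, hgf⟩ := f.exists_leftInverse_of_injective (LinearMap.ker_eq_bot.2 hf)
  have hid : (hatMap g).toLinearMap ∘ₗ (hatMap f).toLinearMap = LinearMap.id := by
    refine doubleExterior_linearMap_ext fun α β => ?_
    have hβ : ExteriorAlgebra.map g (ExteriorAlgebra.map f β) = β := by
      rw [← AlgHom.comp_apply, ExteriorAlgebra.map_comp_map, hgf, ExteriorAlgebra.map_id,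
        AlgHom.id_apply]
    simp [hatMap_hatMul, hβ]
  have hleft : Function.LeftInverse (hatMap g) (hatMap f) := DFunLike.congr_fun hid
  exact hleft.injective

end DoubleExterior

section SecondaryIntegrand

variable {A B : Type*} [Ring A] [Algebra ℝ A] [Ring B] [Algebra ℝ B]

/-- The expression `exp(-R/2) ∑_{k ≥ 1} (-S²)^k / (4k Γ(k+1))` whose Berezin integral is the
Brüning–Ma class, for elements `R` and `S` of an algebra in which both series are finite. -/
def secondaryIntegrand (R S : A) : A :=
  nilExp (-((1 / 2 : ℝ) • R)) *
    ∑ᶠ (k : ℕ) (_ : 1 ≤ k), ((4 * (k : ℝ) * Real.Gamma (k + 1))⁻¹) • (-(S ^ 2)) ^ k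

lemma map_finsum_of_injective {F M N : Type*} {ι : Sort*} [AddCommMonoid M] [AddCommMonoid N]
    [FunLike F M N] [AddMonoidHomClass F M N] (φ : F) (hφ : Function.Injective φ) (f : ι → M) :
    φ (∑ᶠ i, f i) = ∑ᶠ i, φ (f i) :=
  (φ : M →+ N).map_finsum_of_injective hφ f

lemma map_secondaryIntegrand (φ : A →ₐ[ℝ] B) (hφ : Function.Injective φ) (R S : A) :
    φ (secondaryIntegrand R S) = secondaryIntegrand (φ R) (φ S) := by
  simp only [secondaryIntegrand, nilExp, map_mul, map_finsum_of_injective φ hφ, map_smul, map_pow,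
    map_neg]

end SecondaryIntegrand

section Berezin

variable {n : ℕ} {V : Type*} [AddCommGroup V] [Module ℝ V]

lemma topEval_ιMulti_self (e : Module.Basis (Fin n) ℝ V) (f : Fin n → Module.Dual ℝ V) :
    topEval e (ExteriorAlgebra.ιMulti ℝ n f) = e.dualBasis.det f := by
  rw [topEval, ExteriorAlgebra.liftAlternating_apply_ιMulti, Module.Basis.det_apply,
    ← Matrix.det_transpose]
  simp only [dite_true]
  refine congrArg Matrix.det (Matrix.ext fun i j => ?_)
  simp [Module.Basis.toMatrix_apply]

lemma topEval_ιMulti_of_ne (e : Module.Basis (Fin n) ℝ V) {i : ℕ} (h : n ≠ i)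
    (f : Fin i → Module.Dual ℝ V) : topEval e (ExteriorAlgebra.ιMulti ℝ i f) = 0 := by
  rw [topEval, ExteriorAlgebra.liftAlternating_apply_ιMulti]
  simp [h]

lemma topEval_map (e : Module.Basis (Fin n) ℝ V) (f : Module.Dual ℝ V →ₗ[ℝ] Module.Dual ℝ V)
    (β : ExteriorAlgebra ℝ (Module.Dual ℝ V)) :
    topEval e (ExteriorAlgebra.map f β) = LinearMap.det f * topEval e β := by
  suffices h : topEval e ∘ₗ (ExteriorAlgebra.map f).toLinearMap = LinearMap.det f • topEval e from
    DFunLike.congr_fun h β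
  refine ExteriorAlgebra.lhom_ext fun i => AlternatingMap.ext fun v => ?_
  obtain rfl | h := eq_or_ne n i
  · simp [topEval_ιMulti_self, Module.Basis.det_comp]
  · simp [topEval_ιMulti_of_ne e h]

lemma topEval_basis_change (e e' : Module.Basis (Fin n) ℝ V)
    (β : ExteriorAlgebra ℝ (Module.Dual ℝ V)) : topEval e' β = e.det e' * topEval e β := by
  suffices h : topEval e' = e.det e' • topEval e from DFunLike.congr_fun h β
  refine ExteriorAlgebra.lhom_ext fun i => AlternatingMap.ext fun v => ?_
  obtain rfl | h := eq_or_ne n i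
  · have hdet := e'.dualBasis.det.eq_smul_basis_det e.dualBasis
    rw [det_dualBasis_dualBasis] at hdet
    simp [topEval_ιMulti_self, hdet]
  · simp [topEval_ιMulti_of_ne _ h]

lemma berezin_hatMul (e : Module.Basis (Fin n) ℝ V) (ε : ℝ)
    (α β : ExteriorAlgebra ℝ (Module.Dual ℝ V)) :
    berezin e ε (hatMul α β) =
      ((-1) ^ (n * (n + 1) / 2) * Real.pi ^ (-(n : ℝ) / 2) * (ε * topEval e β)) • α := by
  simp [berezin, hatMul, smul_smul, mul_assoc]

lemma berezin_hatMap (e : Module.Basis (Fin n) ℝ V) (ε : ℝ)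
    (f : Module.Dual ℝ V →ₗ[ℝ] Module.Dual ℝ V) (x : DoubleExterior (Module.Dual ℝ V)) :
    berezin e ε (hatMap f x) = berezin e (LinearMap.det f * ε) x := by
  suffices h : berezin e ε ∘ₗ (hatMap f).toLinearMap = berezin e (LinearMap.det f * ε) from
    DFunLike.congr_fun h x
  refine doubleExterior_linearMap_ext fun α β => ?_
  rw [LinearMap.comp_apply, AlgHom.toLinearMap_apply, hatMap_hatMul, berezin_hatMul,
    berezin_hatMul, topEval_map, mul_left_comm ε, mul_assoc (LinearMap.det f)]

lemma berezin_hatMap_smul (e : Module.Basis (Fin n) ℝ V) (ε t : ℝ)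
    (x : DoubleExterior (Module.Dual ℝ V)) :
    berezin e ε (hatMap (t • LinearMap.id) x) = berezin e (t ^ n * ε) x := by
  rw [berezin_hatMap, LinearMap.det_smul, LinearMap.det_id, mul_one,
    Module.finrank_eq_card_basis e.dualBasis, Fintype.card_fin]

lemma berezin_basis_change (e e' : Module.Basis (Fin n) ℝ V) (ε : ℝ) :
    berezin e' ε = berezin e (e.det e' * ε) := by
  refine doubleExterior_linearMap_ext fun α β => ?_
  rw [berezin_hatMul, berezin_hatMul, topEval_basis_change e e', mul_left_comm ε,
    mul_assoc (e.det e')]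
end Berezin


section LeviCivita

variable {d : ℕ} {H : Type*} [TopologicalSpace H] {M : Type*} [TopologicalSpace M]
  [ChartedSpace H M] {I : ModelWithCorners ℝ (Coord d) H}

lemma coordDeriv_const_mul (i : Fin d) (c : ℝ) (f : Coord d → ℝ) (u : Coord d) :
    coordDeriv I i (fun z => c * f z) u = c * coordDeriv I i f u := by
  unfold coordDeriv
  by_cases hu : u ∈ Set.range I
  · exact DFunLike.congr_fun (fderivWithin_const_smul_field (f := f) c (I.uniqueDiffOn u hu)) _
  · have hu' : u ∉ closure (Set.range I) := by rwa [I.isClosed_range.closure_eq]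
    simp [fderivWithin_zero_of_notMem_closure hu']

lemma metricCoeff_smul (c : ℝ) (g : BilinField I M) (p : M) (u : Coord d) :
    metricCoeff (c • g) p u = c • metricCoeff g p u := rfl

lemma christoffel_smul {c : ℝ} (hc : c ≠ 0) (g : BilinField I M) (p : M) :
    christoffel (c • g) p = christoffel g p := by
  funext k i j u
  simp only [christoffel, metricCoeff_smul, matrix_inv_smul, Matrix.smul_apply, smul_eq_mul,
    coordDeriv_const_mul]
  congr 1
  refine Finset.sum_congr rfl fun l _ => ?_
  field_simp

lemma curvatureCoeff_smul {c : ℝ} (hc : c ≠ 0) (g : BilinField I M) (p : M) :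
    curvatureCoeff (c • g) p = curvatureCoeff g p := by
  unfold curvatureCoeff
  rw [christoffel_smul hc]

lemma metricCoeff_posDef [IsManifold I 1 M] {g : BilinField I M}
    (hsymm : ∀ x v w, g x v w = g x w v) (hpos : ∀ x v, v ≠ 0 → 0 < g x v v) {p : M} {u : Coord d}
    (hu : u ∈ (extChartAt I p).target) : (metricCoeff g p u).PosDef := by
  let D := mfderivWithin 𝓘(ℝ, Coord d) I (extChartAt I p).symm (Set.range I) u
  have hD : Function.Injective D := (isInvertible_mfderivWithin_extChartAt_symm hu).injective
  let B : LinearMap.BilinForm ℝ (Coord d) := (g _).compl₁₂ D.toLinearMap D.toLinearMap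
  have hB : metricCoeff g p u =
      LinearMap.BilinForm.toMatrix (EuclideanSpace.basisFun (Fin d) ℝ).toBasis B := by
    ext i j
    simp only [LinearMap.BilinForm.toMatrix_apply, OrthonormalBasis.coe_toBasis,
      EuclideanSpace.basisFun_apply]
    rfl
  rw [hB]
  refine (LinearMap.BilinForm.posDef_toQuadraticMap_iff_matrix _ B ⟨fun v w => hsymm _ _ _⟩).1
    fun v hv => hpos _ _ fun h => hv (hD (h.trans (map_zero D).symm))

/-- The differential `dx^i` at `p` of the `i`-th coordinate of the preferred chart at `p`. -/
def tangentCoordLin (p : M) (i : Fin d) : TangentSpace I p →ₗ[ℝ] ℝ where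
  toFun v := tangentCoord p v i
  map_add' _ _ := rfl
  map_smul' _ _ := rfl

lemma tangentCoordLin_apply (p : M) (i : Fin d) (v : TangentSpace I p) :
    tangentCoordLin p i v = tangentCoord p v i := rfl

/-- The curvature tensor with all indices lowered: `(x, z, v, w) ↦ g(x, R(v, w) z)`. -/
def curvatureTensor (g : BilinField I M) (p : M) :
    TangentSpace I p →ₗ[ℝ] TangentSpace I p →ₗ[ℝ] LinearMap.BilinForm ℝ (TangentSpace I p) :=
  ∑ i, ∑ j, ∑ k,
    (LinearMap.flip (g p) (tangentVec p fun l =>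
      curvatureCoeff g p l i j k (extChartAt I p p))).smulRight
      ((tangentCoordLin p k).smulRight
        ((tangentCoordLin p i).smulRight (tangentCoordLin p j)))

lemma curvature_eq_sum (g : BilinField I M) (p : M) (v w z : TangentSpace I p) :
    curvature g p v w z = ∑ i, ∑ j, ∑ k,
      (tangentCoord p v i * tangentCoord p w j * tangentCoord p z k) •
        (tangentVec p fun l => curvatureCoeff g p l i j k (extChartAt I p p) :
          TangentSpace I p) := by
  let L : (Fin d → ℝ) →ₗ[ℝ] TangentSpace I p :=
    { toFun := tangentVec p
      map_add' := fun _ _ => rfl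
      map_smul' := fun _ _ => rfl }
  change L _ = ∑ i, ∑ j, ∑ k, _ • L _
  simp only [← map_smul, ← map_sum]
  congr 1
  funext l
  simp only [Finset.sum_apply, Pi.smul_apply, smul_eq_mul]

lemma curvatureTensor_apply (g : BilinField I M) (p : M) (x z v w : TangentSpace I p) :
    curvatureTensor g p x z v w = g p x (curvature g p v w z) := by
  simp only [curvatureTensor, curvature_eq_sum, LinearMap.sum_apply, LinearMap.smulRight_apply,
    LinearMap.smul_apply, LinearMap.flip_apply, tangentCoordLin_apply, map_sum, map_smul,
    smul_eq_mul]
  refine Finset.sum_congr rfl fun i _ => Finset.sum_congr rfl fun j _ =>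
    Finset.sum_congr rfl fun k _ => ?_
  ring

lemma curvatureTensor_smul {c : ℝ} (hc : c ≠ 0) (g : BilinField I M) (p : M) :
    curvatureTensor (c • g) p = c • curvatureTensor g p := by
  refine LinearMap.ext₂ fun x z => LinearMap.ext₂ fun v w => ?_
  have hcurv : curvature (c • g) p v w z = curvature g p v w z := by
    unfold curvature
    rw [curvatureCoeff_smul hc]
  rw [curvatureTensor_apply, hcurv]
  exact congrArg (c * ·) (curvatureTensor_apply g p x z v w).symm

end LeviCivita

section Frames

variable {ι ι' V : Type*} [Fintype ι] [Fintype ι'] [AddCommGroup V] [Module ℝ V]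

/-- The product `(v, w) ↦ v ∧ w` of two vectors in the exterior algebra, as a bilinear map. -/
def wedge (V : Type*) [AddCommGroup V] [Module ℝ V] : V →ₗ[ℝ] V →ₗ[ℝ] ExteriorAlgebra ℝ V :=
  (LinearMap.mul ℝ (ExteriorAlgebra ℝ V)).compl₁₂ (ExteriorAlgebra.ι ℝ) (ExteriorAlgebra.ι ℝ)

/-- The two-form `1/2 ∑_{a,b} ω(e_a, e_b) e^a ∧ e^b`. It depends only on the alternating part
of `ω`. -/
def twoForm (e : Module.Basis ι ℝ V) :
    LinearMap.BilinForm ℝ V →ₗ[ℝ] ExteriorAlgebra ℝ (Module.Dual ℝ V) where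
  toFun B := (1 / 2 : ℝ) • ∑ a, ∑ b, B (e a) (e b) • wedge _ (e.coord a) (e.coord b)
  map_add' B C := by
    simp only [LinearMap.add_apply, add_smul, Finset.sum_add_distrib, smul_add]
  map_smul' c B := by
    simp only [LinearMap.smul_apply, smul_assoc, ← Finset.smul_sum, RingHom.id_apply,
      smul_comm c (1 / 2 : ℝ)]

lemma twoForm_eq_of_basis (e : Module.Basis ι ℝ V) (e' : Module.Basis ι' ℝ V) :
    twoForm e = twoForm e' :=
  LinearMap.ext fun B => congrArg ((1 / 2 : ℝ) • ·) <|
    sum_sum_apply_coord_eq e e' B (wedge _) (LinearMap.lsmul ℝ _)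

lemma sqrt_pow_mul_abs_det_eq_one [DecidableEq ι] {s : ℝ} (hs : 0 ≤ s)
    {B : LinearMap.BilinForm ℝ V} {e e' : Module.Basis ι ℝ V}
    (he : LinearMap.BilinForm.toMatrix e B = 1)
    (he' : LinearMap.BilinForm.toMatrix e' (s • B) = 1) :
    √s ^ Fintype.card ι * |e.det e'| = 1 := by
  have hdet : s ^ Fintype.card ι * e.det e' ^ 2 = 1 := by
    have h := congrArg Matrix.det he'
    rwa [map_smul, Matrix.det_smul, det_toMatrix_bilinForm_eq B e e', he,
      Matrix.det_one, mul_one] at h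
  refine (pow_eq_one_iff_of_nonneg (by positivity) two_ne_zero).1 ?_
  rw [mul_pow, sq_abs, ← pow_mul, mul_comm (Fintype.card ι), pow_mul, Real.sq_sqrt hs, hdet]

end Frames

section Boundary

variable {n : ℕ} {X : Type*} [TopologicalSpace X] [ChartedSpace (EuclideanHalfSpace (n + 1)) X]
  [IsManifold (𝓡∂ (n + 1)) ∞ X]

/-- The bilinear form `(v, w) ↦ (∇_v e_m^*)(w)` on the tangent spaces of the boundary, the second
fundamental form up to sign. -/
def normalDerivLin (g : SmoothMetric n X) : BilinField (𝓡 n) (Boundary n X) := fun y =>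
  ∑ i, ∑ j, covDerivForm (metricForm g) y.1 (unitConormalCoeff g y.1) i j
      (extChartAt (𝓡∂ (n + 1)) y.1 y.1) •
    ((tangentCoordLin y.1 i ∘ₗ (boundaryInclusion y).toLinearMap).smulRight
      (tangentCoordLin y.1 j ∘ₗ (boundaryInclusion y).toLinearMap))

variable {y : Boundary n X}

lemma normalDerivLin_apply (g : SmoothMetric n X) (v w : TangentSpace (𝓡 n) y) :
    normalDerivLin g y v w = normalDeriv g y v w := by
  simp only [normalDerivLin, normalDeriv, LinearMap.sum_apply, LinearMap.smul_apply,
    LinearMap.smulRight_apply, LinearMap.comp_apply, tangentCoordLin_apply, smul_eq_mul]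
  exact Finset.sum_congr rfl fun i _ => Finset.sum_congr rfl fun j _ => mul_comm _ _

lemma curvatureForm_eq_twoForm (g : SmoothMetric n X)
    (e : Module.Basis (Fin n) ℝ (TangentSpace (𝓡 n) y)) (k j : Fin n) :
    curvatureForm g y e k j = twoForm e (curvatureTensor (boundaryMetric g) y (e k) (e j)) := by
  simp only [curvatureForm, ← curvatureTensor_apply]
  rfl

lemma dotS_eq_of_basis (g : SmoothMetric n X)
    (e e' : Module.Basis (Fin n) ℝ (TangentSpace (𝓡 n) y)) : dotS g y e = dotS g y e' := by
  simp only [dotS, ← normalDerivLin_apply]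
  exact congrArg ((1 / 2 : ℝ) • ·) <| sum_sum_apply_coord_eq e e' (normalDerivLin g y)
    ((hatMulLin _).compl₁₂ (ExteriorAlgebra.ι ℝ) (ExteriorAlgebra.ι ℝ)) (LinearMap.lsmul ℝ _)

lemma dotR_eq_of_basis (g : SmoothMetric n X)
    (e e' : Module.Basis (Fin n) ℝ (TangentSpace (𝓡 n) y)) : dotR g y e = dotR g y e' := by
  simp only [dotR, curvatureForm_eq_twoForm, twoForm_eq_of_basis e e']
  exact congrArg ((1 / 2 : ℝ) • ·) <| sum_sum_apply_coord_eq e e'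
    ((curvatureTensor (boundaryMetric g) y).compr₂ (twoForm e')) (wedge _) (hatMulLin _)

lemma hatMap_smul_dotS (t : ℝ) (g : SmoothMetric n X)
    (e : Module.Basis (Fin n) ℝ (TangentSpace (𝓡 n) y)) :
    hatMap (t • LinearMap.id) (dotS g y e) = t • dotS g y e := by
  simp only [dotS, coframe, map_smul, map_sum, hatMap_hatMul, ExteriorAlgebra.map_apply_ι,
    LinearMap.smul_apply, LinearMap.id_apply, hatMul_smul_right, Finset.smul_sum, smul_comm t]

lemma hatMap_smul_dotR (t : ℝ) (g : SmoothMetric n X)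
    (e : Module.Basis (Fin n) ℝ (TangentSpace (𝓡 n) y)) :
    hatMap (t • LinearMap.id) (dotR g y e) = t ^ 2 • dotR g y e := by
  simp only [dotR, coframe, map_smul, map_sum, hatMap_hatMul, map_mul,
    ExteriorAlgebra.map_apply_ι, LinearMap.smul_apply, LinearMap.id_apply, smul_mul_smul_comm,
    hatMul_smul_right, Finset.smul_sum, smul_comm (t ^ 2), ← sq]

lemma tangentCoord_boundaryInclusion_zero (v : TangentSpace (𝓡 n) y) :
    tangentCoord y.1 (boundaryInclusion y v) 0 = 0 := by
  unfold boundaryInclusion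
  rw [(hasMFDerivAt_boundary_val y).mfderiv]
  rfl

lemma tangentCoord_unitNormal_zero_pos (g : SmoothMetric n X) (y : Boundary n X) :
    0 < tangentCoord y.1 (unitNormal g y) 0 := by
  have : IsManifold (𝓡∂ (n + 1)) 1 X := IsManifold.of_le (n := ∞) (by simp)
  have hpos := (metricCoeff_posDef (g := metricForm g) g.symm g.pos
    (mem_extChartAt_target y.1)).inv.diag_pos (i := 0)
  exact div_pos hpos (Real.sqrt_pos.2 hpos)

lemma unitNormal_notMem_range_boundaryInclusion (g : SmoothMetric n X) (y : Boundary n X) :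
    unitNormal g y ∉ LinearMap.range (boundaryInclusion y).toLinearMap := by
  rintro ⟨v, hv⟩
  exact (tangentCoord_unitNormal_zero_pos g y).ne
    (hv ▸ (tangentCoord_boundaryInclusion_zero v).symm)

lemma exists_outwardFrame (g : SmoothMetric n X)
    (e : Module.Basis (Fin n) ℝ (TangentSpace (𝓡 n) y)) :
    ∃ b : Module.Basis (Fin (n + 1)) ℝ (TangentSpace (𝓡∂ (n + 1)) y.1),
      b 0 = -unitNormal g y ∧ ∀ i, b i.succ = boundaryInclusion y (e i) := by
  have : FiniteDimensional ℝ (TangentSpace (𝓡∂ (n + 1)) y.1) :=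
    inferInstanceAs (FiniteDimensional ℝ (Coord (n + 1)))
  refine exists_basis_finCons (finrank_euclideanSpace_fin (𝕜 := ℝ) (n := n + 1))
    (J := (boundaryInclusion y).toLinearMap) (boundaryInclusion_injective y) e fun h => ?_
  exact unitNormal_notMem_range_boundaryInclusion g y (neg_mem_iff.1 h)

lemma frameSign_eq_orientationSign (o : ManifoldOrientation n X) {g : SmoothMetric n X}
    {e : Module.Basis (Fin n) ℝ (TangentSpace (𝓡 n) y)}
    {b : Module.Basis (Fin (n + 1)) ℝ (TangentSpace (𝓡∂ (n + 1)) y.1)}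
    (h₀ : b 0 = -unitNormal g y) (hb : ∀ i, b i.succ = boundaryInclusion y (e i)) :
    frameSign o g y e = orientationSign (o.orient y.1) b := by
  unfold frameSign orientationSign
  congr 1
  refine propext ⟨?_, fun h => ⟨b, h₀, hb, h⟩⟩
  rintro ⟨b', h₀', hb', h⟩
  have hbb' : b' = b := Module.Basis.eq_of_apply_eq <|
    Fin.cases (h₀'.trans h₀.symm) fun i => (hb' i).trans (hb i).symm
  rwa [← hbb']

lemma det_mul_frameSign (o : ManifoldOrientation n X) {g₁ g₂ : SmoothMetric n X} {c : ℝ}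
    (hc : 0 < c) (hν : unitNormal g₂ y = c • unitNormal g₁ y)
    (e e' : Module.Basis (Fin n) ℝ (TangentSpace (𝓡 n) y)) :
    e.det e' * frameSign o g₂ y e' = |e.det e'| * frameSign o g₁ y e := by
  obtain ⟨b, h₀, hb⟩ := exists_outwardFrame g₁ e
  obtain ⟨b', h₀', hb'⟩ := exists_outwardFrame g₂ e'
  have hdet : b.det b' = c * e.det e' :=
    det_finCons_eq_mul_det (boundaryInclusion y).toLinearMap (by rw [h₀', h₀, hν, smul_neg]) hb hb'
  have hsign := det_mul_orientationSign (o.orient y.1) b b'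
  rw [hdet, abs_mul, abs_of_pos hc, mul_assoc, mul_assoc] at hsign
  rw [frameSign_eq_orientationSign o h₀ hb, frameSign_eq_orientationSign o h₀' hb']
  exact mul_left_cancel₀ hc.ne' hsign

lemma IsOrthonormalFrame.toMatrix_eq_one {g : SmoothMetric n X}
    {e : Module.Basis (Fin n) ℝ (TangentSpace (𝓡 n) y)} (he : IsOrthonormalFrame g y e) :
    LinearMap.BilinForm.toMatrix e (boundaryMetric g y) = 1 := by
  ext i j
  rw [LinearMap.BilinForm.toMatrix_apply, he i j, Matrix.one_apply]

end Boundary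

section Scaling

variable {n : ℕ} {X : Type*} [TopologicalSpace X] [ChartedSpace (EuclideanHalfSpace (n + 1)) X]
  [IsManifold (𝓡∂ (n + 1)) ∞ X] {g₁ g₂ : SmoothMetric n X} {s : ℝ}

lemma boundaryMetric_smul (h : metricForm g₂ = s • metricForm g₁) :
    boundaryMetric g₂ = s • boundaryMetric g₁ := by
  unfold boundaryMetric
  rw [h]
  rfl

lemma unitNormalCoeff_smul (hs : 0 < s) (h : metricForm g₂ = s • metricForm g₁) (p : X)
    (k : Fin (n + 1)) (u : Coord (n + 1)) :
    unitNormalCoeff g₂ p k u = (√s)⁻¹ * unitNormalCoeff g₁ p k u := by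
  have hsqrt : s⁻¹ / √s⁻¹ = (√s)⁻¹ := by rw [Real.div_sqrt, Real.sqrt_inv]
  simp only [unitNormalCoeff, h, metricCoeff_smul, matrix_inv_smul, Matrix.smul_apply, smul_eq_mul]
  rw [Real.sqrt_mul (inv_nonneg.2 hs.le), mul_div_mul_comm, hsqrt]

lemma unitNormal_smul (hs : 0 < s) (h : metricForm g₂ = s • metricForm g₁) (y : Boundary n X) :
    unitNormal g₂ y = (√s)⁻¹ • unitNormal g₁ y := by
  simp only [unitNormal, unitNormalCoeff_smul hs h]
  rfl

lemma unitConormalCoeff_smul (hs : 0 < s) (h : metricForm g₂ = s • metricForm g₁) (p : X)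
    (j : Fin (n + 1)) (u : Coord (n + 1)) :
    unitConormalCoeff g₂ p j u = √s * unitConormalCoeff g₁ p j u := by
  have hsqrt : s * (√s)⁻¹ = √s := by rw [← div_eq_mul_inv, Real.div_sqrt]
  rw [unitConormalCoeff, unitConormalCoeff, Finset.mul_sum]
  refine Finset.sum_congr rfl fun k _ => ?_
  rw [h, metricCoeff_smul, unitNormalCoeff_smul hs h, Matrix.smul_apply, smul_eq_mul,
    mul_mul_mul_comm, hsqrt]

lemma normalDeriv_smul (hs : 0 < s) (h : metricForm g₂ = s • metricForm g₁) {y : Boundary n X}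
    (v w : TangentSpace (𝓡 n) y) : normalDeriv g₂ y v w = √s * normalDeriv g₁ y v w := by
  have hθ : ∀ j, unitConormalCoeff g₂ y.1 j = fun u => √s * unitConormalCoeff g₁ y.1 j u :=
    fun j => funext (unitConormalCoeff_smul hs h y.1 j)
  simp only [normalDeriv, covDerivForm, h, christoffel_smul hs.ne', hθ, coordDeriv_const_mul,
    mul_left_comm _ (√s), ← Finset.mul_sum, ← mul_sub]

lemma dotS_smul (hs : 0 < s) (h : metricForm g₂ = s • metricForm g₁) {y : Boundary n X}
    (e : Module.Basis (Fin n) ℝ (TangentSpace (𝓡 n) y)) : dotS g₂ y e = √s • dotS g₁ y e := by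
  simp only [dotS, normalDeriv_smul hs h, Finset.smul_sum, smul_smul,
    mul_left_comm (√s)]

lemma dotR_smul (hs : s ≠ 0) (h : metricForm g₂ = s • metricForm g₁) {y : Boundary n X}
    (e : Module.Basis (Fin n) ℝ (TangentSpace (𝓡 n) y)) : dotR g₂ y e = s • dotR g₁ y e := by
  simp only [dotR, curvatureForm_eq_twoForm, boundaryMetric_smul h, curvatureTensor_smul hs,
    LinearMap.smul_apply, map_smul, hatMul_smul_left, ← Finset.smul_sum, smul_comm s]

lemma secondaryIntegrand_smul (hs : 0 < s) (h : metricForm g₂ = s • metricForm g₁)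
    {y : Boundary n X} (e₁ e₂ : Module.Basis (Fin n) ℝ (TangentSpace (𝓡 n) y)) :
    secondaryIntegrand (dotR g₂ y e₂) (dotS g₂ y e₂) =
      hatMap (√s • LinearMap.id) (secondaryIntegrand (dotR g₁ y e₁) (dotS g₁ y e₁)) := by
  have hinj : Function.Injective
      (√s • LinearMap.id : Module.End ℝ (Module.Dual ℝ (TangentSpace (𝓡 n) y))) :=
    smul_right_injective _ (Real.sqrt_pos.2 hs).ne'
  rw [map_secondaryIntegrand _ (hatMap_injective hinj), hatMap_smul_dotR, hatMap_smul_dotS,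
    Real.sq_sqrt hs.le, ← dotR_smul hs.ne' h, ← dotS_smul hs h, dotR_eq_of_basis g₂ e₁ e₂,
    dotS_eq_of_basis g₂ e₁ e₂]

lemma secondaryFormIn_eq_of_smul (o : ManifoldOrientation n X) (hs : 0 < s)
    (h : metricForm g₂ = s • metricForm g₁) {y : Boundary n X}
    {e₁ e₂ : Module.Basis (Fin n) ℝ (TangentSpace (𝓡 n) y)} (he₁ : IsOrthonormalFrame g₁ y e₁)
    (he₂ : IsOrthonormalFrame g₂ y e₂) :
    secondaryFormIn o g₁ y e₁ = secondaryFormIn o g₂ y e₂ := by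
  have hdet : √s ^ n * |e₁.det e₂| = 1 := by
    have he₂' : LinearMap.BilinForm.toMatrix e₂ (s • boundaryMetric g₁ y) = 1 := by
      rw [← he₂.toMatrix_eq_one, boundaryMetric_smul h]
      rfl
    simpa only [Fintype.card_fin] using
      sqrt_pow_mul_abs_det_eq_one hs.le he₁.toMatrix_eq_one he₂'
  have hsign := det_mul_frameSign o (inv_pos.2 (Real.sqrt_pos.2 hs)) (unitNormal_smul hs h y) e₁ e₂
  calc secondaryFormIn o g₁ y e₁
    _ = berezin e₁ (frameSign o g₁ y e₁)
          (secondaryIntegrand (dotR g₁ y e₁) (dotS g₁ y e₁)) := rfl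
    _ = berezin e₁ (√s ^ n * (e₁.det e₂ * frameSign o g₂ y e₂))
          (secondaryIntegrand (dotR g₁ y e₁) (dotS g₁ y e₁)) := by
      rw [hsign, ← mul_assoc, hdet, one_mul]
    _ = berezin e₂ (frameSign o g₂ y e₂)
          (hatMap (√s • LinearMap.id) (secondaryIntegrand (dotR g₁ y e₁) (dotS g₁ y e₁))) := by
      rw [berezin_basis_change e₁ e₂, berezin_hatMap_smul]
    _ = secondaryFormIn o g₂ y e₂ := by
      rw [← secondaryIntegrand_smul hs h e₁ e₂]
      rfl

end Scaling

end BoundaryAnomaly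

end

theorem proposition3p1_general (n : ℕ) {X : Type*} [TopologicalSpace X]
    [ChartedSpace (EuclideanHalfSpace (n + 1)) X] [IsManifold (𝓡∂ (n + 1)) ∞ X]
    (o : BoundaryAnomaly.ManifoldOrientation n X) (g₁ g₂ : BoundaryAnomaly.SmoothMetric n X)
    (s : ℝ) (hs : 0 < s)
    (hg : ∀ (x : X) (v w : TangentSpace (𝓡∂ (n + 1)) x),
      g₂.inner x v w = s * g₁.inner x v w) :
    BoundaryAnomaly.secondaryForm o g₁ = BoundaryAnomaly.secondaryForm o g₂ := by
  have h : BoundaryAnomaly.metricForm g₂ = s • BoundaryAnomaly.metricForm g₁ :=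
    funext fun x => LinearMap.ext₂ (hg x)
  funext y
  exact BoundaryAnomaly.secondaryFormIn_eq_of_smul o hs h
    (BoundaryAnomaly.exists_orthonormalFrame g₁ y).choose_spec
    (BoundaryAnomaly.exists_orthonormalFrame g₂ y).choose_spec

theorem proposition3p1 (n : ℕ) (hn : Odd (n + 1)) {X : Type*} [TopologicalSpace X] [T2Space X]
    [CompactSpace X] [ChartedSpace (EuclideanHalfSpace (n + 1)) X]
    [IsManifold (𝓡∂ (n + 1)) ∞ X] (o : BoundaryAnomaly.ManifoldOrientation n X)
    (g₁ g₂ : BoundaryAnomaly.SmoothMetric n X) (s : ℝ) (hs : 0 < s)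
    (hg : ∀ (x : X) (v w : TangentSpace (𝓡∂ (n + 1)) x),
      g₂.inner x v w = s * g₁.inner x v w) :
    BoundaryAnomaly.secondaryForm o g₁ = BoundaryAnomaly.secondaryForm o g₂ :=
  proposition3p1_general n o g₁ g₂ s hs hg
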